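/- **Languages.** Let $\mathit{Var}$ be a countable set of variables. Let $Fm$ be the set of formulae over $\mathit{Var}$ built with $\neg,\lor,\to$, and use the abbreviations $\phi\land\psi:=\neg(\neg\phi\lor\neg\psi)$, $\phi\supset\psi:=\neg\phi\lor\psi$, $\phi\equiv\psi:=(\phi\supset\psi)\land(\psi\supset\phi)$, $\phi\prec\psi:=\psi\to(\phi\lor\neg\phi)$. Let $Fm^{\land}$ be the set of formulae built with $\neg,\land,\lor,\to$ ($\land$ primitive), so that $Fm\subseteq Fm^\land$, and for $\phi\in Fm^\land$ let $\phi^*\in Fm$ be the result of replacing each primitive conjunction by the abbreviation above. **The calculus $\mathbf{DAI}_0$.** $\Gamma\vdash_{\mathbf{DAI}_0}\phi$ (for $\Gamma\cup\{\phi\}\subseteq Fm$) means that $\phi$ is derivable from $\Gamma$ and the following axiom schemata by the single rule $\phi,\ \phi\supset\psi\vdash\psi$: - (A1) $\phi\supset(\psi\supset\phi)$; (A2) $(\phi\supset(\psi\supset\chi))\supset((\phi\supset\psi)\supset(\phi\supset\chi))$; (A3) $(\neg\phi\supset\neg\psi)\supset(\psi\supset\phi)$; ($\lor$) $(\phi\lor\psi)\equiv(\neg\phi\supset\psi)$;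 - (A4) $(\phi\to\psi)\equiv((\phi\supset\psi)\land(\psi\prec\phi))$; - (O1) $\phi\prec\phi$; (O2) $((\phi\prec\psi)\land(\psi\prec\chi))\supset(\phi\prec\chi)$; (O3) $(\phi\prec\psi)\supset((\phi\lor\psi)\prec\psi)$; (O4) $((\phi\prec\psi)\equiv(\phi\prec\neg\psi))\land((\phi\prec\psi)\equiv(\neg\phi\prec\psi))$; - (C1) $(\phi\prec(\phi\lor\psi))\land(\psi\prec(\phi\lor\psi))$; (C2) $((\phi\prec\chi)\land(\psi\prec\chi))\supset((\phi\lor\psi)\prec\chi)$; (C3) $((\phi\prec\chi)\land(\chi\prec\phi)\land(\psi\prec\zeta)\land(\zeta\prec\psi))\supset((\phi\to\psi)\prec(\chi\to\zeta))$. **The logic $\mathbf{CA\text{-}DAI}$.** A *$\mathbf{CA\text{-}PAI}$-model* consists of a reflexive transitive frame $\langle W,R\rangle$; a valuation $v:\mathit{Var}\to\mathscr P(W)$; for every $w\in W$ a join-semilattice $\langle T_w,\oplus_w\rangle$, with order $\leq_w$, and an arbitrary binary operation $\multimap_w$ on $T_w$; for every $w\in W$ a map $t_w:Fm^\land\to T_w$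 with $t_w(\neg\phi)=t_w(\phi)$, $t_w(\phi\land\psi)=t_w(\phi\lor\psi)=t_w(\phi)\oplus_w t_w(\psi)$ and $t_w(\phi\to\psi)=t_w(\phi)\multimap_w t_w(\psi)$; and, whenever $wRw'$, a homomorphism $h_{ww'}:\langle T_w,\oplus_w,\multimap_w\rangle\to\langle T_{w'},\oplus_{w'},\multimap_{w'}\rangle$ with $h_{ww'}(t_w(p))=t_{w'}(p)$ for every variable $p$. Truth at a world is given by $v$ for variables, is classical for $\neg,\land,\lor$, and $w\Vdash\phi\to\psi$ iff $t_w(\psi)\leq_w t_w(\phi)$ and, for all $w'$ with $wRw'$, $w'\Vdash\phi$ implies $w'\Vdash\psi$. $\mathbf{CA\text{-}PAI}$ is the (local) consequence relation of this class: $\Gamma\vdash_{\mathbf{CA\text{-}PAI}}\phi$ iff in every model $\phi$ is true at every world at which all members of $\Gamma$ are true. $\mathbf{CA\text{-}DAI}$ is its axiomatic extension by the schema $\phi\supset((\phi\supset\phi)\to\phi)$: $\Gamma\vdash_{\mathbf{CA\text{-}DAI}}\phi$ iff $\phi$ follows in $\mathbf{CA\text{-}PAI}$ from $\Gamma$ together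 with all instances of that schema in $Fm^\land$. **Theorem.** $\mathbf{DAI}_0$ and $\mathbf{CA\text{-}DAI}$ are the same logic: for all $\Gamma\cup\{\phi\}\subseteq Fm$, $$\Gamma\vdash_{\mathbf{DAI}_0}\phi\iff\Gamma\vdash_{\mathbf{CA\text{-}DAI}}\phi,$$ and for all $\Gamma\cup\{\phi\}\subseteq Fm^\land$ (reading $\land$ as the abbreviation), $$\Gamma\vdash_{\mathbf{CA\text{-}DAI}}\phi\iff\{\gamma^*:\gamma\in\Gamma\}\vdash_{\mathbf{DAI}_0}\phi^*.$$ -/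

import Mathlib

universe u v

namespace AnalyticImplication

/-- Formulae of the language `⟨¬, ∨, →⟩` over a set of variables. -/
inductive Fm (Var : Type) : Type
  | var : Var → Fm Var
  | neg : Fm Var → Fm Var
  | or : Fm Var → Fm Var → Fm Var
  | imp : Fm Var → Fm Var → Fm Var

namespace Fm

variable {Var : Type}

/-- Conjunction `¬(¬φ ∨ ¬ψ)`. -/
def and (φ ψ : Fm Var) : Fm Var := neg (or (neg φ) (neg ψ))

/-- Material implication `φ ⊃ ψ`, i.e. `¬φ ∨ ψ`. -/
def mat (φ ψ : Fm Var) : Fm Var := or (neg φ) ψ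

/-- Material equivalence `φ ≡ ψ`. -/
def equ (φ ψ : Fm Var) : Fm Var := and (mat φ ψ) (mat ψ φ)

/-- Content inclusion `φ ≺ ψ`, i.e. `ψ → (φ ∨ ¬φ)`. -/
def prec (φ ψ : Fm Var) : Fm Var := imp ψ (or φ (neg φ))

end Fm

open Fm in
/-- The axioms of `DAI₀`. The schema `orDef` makes the classical part complete: since `φ ⊃ ψ` is
the formula `¬φ ∨ ψ`, the schemata `a1`, `a2`, `a3` alone say nothing about a disjunction whose
first member is not a negation. -/
inductive DAI0Axiom {Var : Type} : Fm Var → Prop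
  | a1 (φ ψ : Fm Var) : DAI0Axiom (mat φ (mat ψ φ))
  | a2 (φ ψ χ : Fm Var) :
      DAI0Axiom (mat (mat φ (mat ψ χ)) (mat (mat φ ψ) (mat φ χ)))
  | a3 (φ ψ : Fm Var) : DAI0Axiom (mat (mat (neg φ) (neg ψ)) (mat ψ φ))
  | orDef (φ ψ : Fm Var) : DAI0Axiom (equ (or φ ψ) (mat (neg φ) ψ))
  | a4 (φ ψ : Fm Var) : DAI0Axiom (equ (imp φ ψ) (and (mat φ ψ) (prec ψ φ)))
  | o1 (φ : Fm Var) : DAI0Axiom (prec φ φ)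
  | o2 (φ ψ χ : Fm Var) : DAI0Axiom (mat (and (prec φ ψ) (prec ψ χ)) (prec φ χ))
  | o3 (φ ψ : Fm Var) : DAI0Axiom (mat (prec φ ψ) (prec (or φ ψ) ψ))
  | o4 (φ ψ : Fm Var) :
      DAI0Axiom (and (equ (prec φ ψ) (prec φ (neg ψ))) (equ (prec φ ψ) (prec (neg φ) ψ)))
  | c1 (φ ψ : Fm Var) : DAI0Axiom (and (prec φ (or φ ψ)) (prec ψ (or φ ψ)))
  | c2 (φ ψ χ : Fm Var) : DAI0Axiom (mat (and (prec φ χ) (prec ψ χ)) (prec (or φ ψ) χ))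
  | c3 (φ ψ χ ζ : Fm Var) :
      DAI0Axiom (mat (and (and (and (prec φ χ) (prec χ φ)) (prec ψ ζ)) (prec ζ ψ))
        (prec (imp φ ψ) (imp χ ζ)))

/-- `DAI0 Γ φ`: derivability of `φ` from the premises `Γ` in the Hilbert calculus `DAI₀`. -/
inductive DAI0 {Var : Type} (Γ : Set (Fm Var)) : Fm Var → Prop
  | hyp {φ : Fm Var} : φ ∈ Γ → DAI0 Γ φ
  | ax {φ : Fm Var} : DAI0Axiom φ → DAI0 Γ φ
  | mp {φ ψ : Fm Var} : DAI0 Γ φ → DAI0 Γ (Fm.mat φ ψ) → DAI0 Γ ψ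

/-- Formulae of the language `⟨¬, ∧, ∨, →⟩`, in which conjunction is primitive. -/
inductive FmC (Var : Type) : Type
  | var : Var → FmC Var
  | neg : FmC Var → FmC Var
  | and : FmC Var → FmC Var → FmC Var
  | or : FmC Var → FmC Var → FmC Var
  | imp : FmC Var → FmC Var → FmC Var

/-- Material implication `φ ⊃ ψ`, i.e. `¬φ ∨ ψ`. -/
def FmC.mat {Var : Type} (φ ψ : FmC Var) : FmC Var := FmC.or (FmC.neg φ) ψ

/-- The inclusion of the language `⟨¬, ∨, →⟩` in `⟨¬, ∧, ∨, →⟩`. -/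
def Fm.incl {Var : Type} : Fm Var → FmC Var
  | .var p => .var p
  | .neg φ => .neg φ.incl
  | .or φ ψ => .or φ.incl ψ.incl
  | .imp φ ψ => .imp φ.incl ψ.incl

/-- Reading the primitive conjunction as the abbreviation `¬(¬φ ∨ ¬ψ)`. -/
def FmC.unfold {Var : Type} : FmC Var → Fm Var
  | .var p => .var p
  | .neg φ => .neg φ.unfold
  | .and φ ψ => Fm.and φ.unfold ψ.unfold
  | .or φ ψ => .or φ.unfold ψ.unfold
  | .imp φ ψ => .imp φ.unfold ψ.unfold

/-- Models of conditional-agnostic analytic implication: an S4 frame, at each world a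
join-semilattice of topics with an arbitrary binary operation `cond`, and for `R w w'` a
homomorphism of these algebras from the topics at `w` to those at `w'` which carries the topic
of every variable at `w` to its topic at `w'`. -/
structure CAPAIModel (Var : Type) where
  W : Type u
  R : W → W → Prop
  R_refl : ∀ w, R w w
  R_trans : ∀ w₁ w₂ w₃, R w₁ w₂ → R w₂ w₃ → R w₁ w₃
  T : W → Type v
  [semilattice : ∀ w, SemilatticeSup (T w)]
  cond : ∀ w, T w → T w → T w
  val : Var → Set W
  t : ∀ w, FmC Var → T w
  t_neg : ∀ w φ, t w (.neg φ) = t w φ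
  t_and : ∀ w φ ψ, t w (.and φ ψ) = t w φ ⊔ t w ψ
  t_or : ∀ w φ ψ, t w (.or φ ψ) = t w φ ⊔ t w ψ
  t_imp : ∀ w φ ψ, t w (.imp φ ψ) = cond w (t w φ) (t w ψ)
  h : ∀ w w', R w w' → T w → T w'
  h_sup : ∀ w w' (r : R w w') (a b : T w), h w w' r (a ⊔ b) = h w w' r a ⊔ h w w' r b
  h_cond : ∀ w w' (r : R w w') (a b : T w),
    h w w' r (cond w a b) = cond w' (h w w' r a) (h w w' r b)
  h_var : ∀ w w' (r : R w w') (p : Var), h w w' r (t w (.var p)) = t w' (.var p)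

attribute [instance] CAPAIModel.semilattice

/-- Truth of a formula at a world. The arrow is strict implication together with inclusion of
the topic of the consequent in the topic of the antecedent. -/
def CAPAIModel.Forces {Var : Type} (M : CAPAIModel.{u, v} Var) : M.W → FmC Var → Prop
  | w, .var p => w ∈ M.val p
  | w, .neg φ => ¬ M.Forces w φ
  | w, .and φ ψ => M.Forces w φ ∧ M.Forces w ψ
  | w, .or φ ψ => M.Forces w φ ∨ M.Forces w ψ
  | w, .imp φ ψ => M.t w ψ ≤ M.t w φ ∧ ∀ w', M.R w w' → M.Forces w' φ → M.Forces w' ψ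

/-- The logic `CA-PAI`: (local) consequence over the class of its models. -/
def CAPAI {Var : Type} (Γ : Set (FmC Var)) (φ : FmC Var) : Prop :=
  ∀ (M : CAPAIModel.{u, v} Var) (w : M.W), (∀ γ ∈ Γ, M.Forces w γ) → M.Forces w φ

/-- All instances of the demodalizing schema `φ ⊃ ((φ ⊃ φ) → φ)`. -/
def demodalizer (Var : Type) : Set (FmC Var) :=
  Set.range fun φ : FmC Var => FmC.mat φ (FmC.imp (FmC.mat φ φ) φ)

/-- The logic `CA-DAI`: the axiomatic extension of `CA-PAI` by the demodalizing schema. -/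
def CADAI {Var : Type} (Γ : Set (FmC Var)) (φ : FmC Var) : Prop :=
  CAPAI.{u, v} (Γ ∪ demodalizer Var) φ

end AnalyticImplication

/-! Both logics are the logic of single worlds. If the demodalizing schema holds at `w`, its
instances for `ψ` and `¬ψ` make truth constant along `R` from `w` (`forces_congr`). There `φ → ψ`
reduces to material implication plus topic inclusion, and `φ ≺ ψ` to topic inclusion, so the axioms
can be checked at `w` (`forces_incl_axiom`).

Conversely, a non-derivable formula is omitted by a complete theory (`exists_isCompleteTheory`). The
axioms on `≺` make formulae modulo mutual inclusion a join-semilattice with an operation for `→`,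
hence a one-world model whose truths are that theory (`forces_iff`). Neither truth nor topic
separates `∧` from its abbreviation, so both languages are handled together. -/

namespace AnalyticImplication

/-! ### Classical reasoning in the calculus -/

namespace DAI0

open Fm

variable {Var : Type} {Γ Δ : Set (Fm Var)} {φ ψ χ : Fm Var}

theorem mono (h : Γ ⊆ Δ) (d : DAI0 Γ φ) : DAI0 Δ φ := by
  induction d with
  | hyp m => exact .hyp (h m)
  | ax a => exact .ax a
  | mp _ _ ih₁ ih₂ => exact .mp ih₁ ih₂

theorem mat_intro (d : DAI0 Γ φ) : DAI0 Γ (mat ψ φ) :=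
  .mp d (.ax (.a1 _ _))

theorem mat_mp (d : DAI0 Γ (mat φ (mat ψ χ))) (e : DAI0 Γ (mat φ ψ)) : DAI0 Γ (mat φ χ) :=
  .mp e (.mp d (.ax (.a2 _ _ _)))

theorem mat_self : DAI0 Γ (mat φ φ) :=
  mat_mp (.ax (.a1 φ (mat φ φ))) (.ax (.a1 φ φ))

/-- The deduction theorem. -/
theorem deduction (d : DAI0 (insert ψ Γ) φ) : DAI0 Γ (mat ψ φ) := by
  induction d with
  | hyp m =>
    rcases m with rfl | m
    · exact mat_self
    · exact mat_intro (.hyp m)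
  | ax a => exact mat_intro (.ax a)
  | mp _ _ ih₁ ih₂ => exact mat_mp ih₂ ih₁

theorem explosion (d : DAI0 Γ φ) (e : DAI0 Γ (neg φ)) : DAI0 Γ ψ :=
  .mp d (.mp (mat_intro e) (.ax (.a3 ψ φ)))

theorem by_contradiction (h : ∀ χ, DAI0 (insert (neg φ) Γ) χ) : DAI0 Γ φ :=
  -- With no falsum in the language, the refuted formula is the theorem `φ ⊃ φ`; contraposition then
  -- gives `(φ ⊃ φ) ⊃ φ`.
  .mp (mat_self (φ := φ)) (.mp (deduction (h (neg (mat φ φ)))) (.ax (.a3 _ _)))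

theorem of_neg_neg (d : DAI0 Γ (neg (neg φ))) : DAI0 Γ φ :=
  by_contradiction fun _ =>
    explosion (.hyp (Set.mem_insert _ _)) (d.mono (Set.subset_insert _ _))

theorem cases_on_neg (d : DAI0 Γ (mat ψ φ)) (e : DAI0 Γ (mat (neg ψ) φ)) : DAI0 Γ φ := by
  refine by_contradiction fun χ => ?_
  have hφ : DAI0 (insert (neg φ) Γ) (neg φ) := .hyp (Set.mem_insert _ _)
  have hψ : DAI0 (insert (neg φ) Γ) (neg ψ) := by
    refine by_contradiction fun θ => explosion (φ := φ) ?_ (hφ.mono (Set.subset_insert _ _))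
    exact .mp (of_neg_neg (.hyp (Set.mem_insert _ _)))
      (d.mono ((Set.subset_insert _ _).trans (Set.subset_insert _ _)))
  exact explosion (.mp hψ (e.mono (Set.subset_insert _ _))) hφ

/-- A derivation uses premises from a single member of a nonempty chain. -/
theorem exists_of_sUnion {c : Set (Set (Fm Var))} (hc : IsChain (· ⊆ ·) c) (hne : c.Nonempty)
    (d : DAI0 (⋃₀ c) φ) : ∃ s ∈ c, DAI0 s φ := by
  induction d with
  | hyp m =>
    obtain ⟨s, hs, m⟩ := m
    exact ⟨s, hs, .hyp m⟩
  | ax a =>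
    obtain ⟨s, hs⟩ := hne
    exact ⟨s, hs, .ax a⟩
  | mp _ _ ih₁ ih₂ =>
    obtain ⟨s, hs, d⟩ := ih₁
    obtain ⟨s', hs', e⟩ := ih₂
    rcases hc.total hs hs' with h | h
    · exact ⟨s', hs', .mp (d.mono h) e⟩
    · exact ⟨s, hs, .mp d (e.mono h)⟩

end DAI0

/-- Deductively closed sets of formulae that contain exactly one of `φ` and `¬φ` for each `φ`. -/
structure IsCompleteTheory {Var : Type} (Δ : Set (Fm Var)) : Prop where
  mem_of_derivable : ∀ {φ}, DAI0 Δ φ → φ ∈ Δ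
  mem_neg : ∀ {φ}, Fm.neg φ ∈ Δ ↔ φ ∉ Δ

/-- Lindenbaum's lemma. -/
theorem exists_isCompleteTheory {Var : Type} {Γ : Set (Fm Var)} {φ : Fm Var}
    (h : ¬ DAI0 Γ φ) : ∃ Δ, Γ ⊆ Δ ∧ IsCompleteTheory Δ ∧ φ ∉ Δ := by
  obtain ⟨Δ, hΓ, hmax⟩ := zorn_subset_nonempty {Δ | ¬ DAI0 Δ φ}
    (fun c hc hch hne => ⟨⋃₀ c, fun d => by
      obtain ⟨s, hs, d⟩ := DAI0.exists_of_sUnion hch hne d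
      exact hc hs d, fun s hs => Set.subset_sUnion_of_mem hs⟩) Γ h
  have hφ : ¬ DAI0 Δ φ := hmax.prop
  -- By maximality, adding any `ψ ∉ Δ` makes `φ` derivable.
  have hext : ∀ ψ, ψ ∉ Δ → DAI0 Δ (Fm.mat ψ φ) := fun ψ hψ => by
    refine DAI0.deduction (not_not.1 fun hn => hψ ?_)
    exact hmax.le_of_ge hn (Set.subset_insert _ _) (Set.mem_insert _ _)
  have hclosed : ∀ {ψ}, DAI0 Δ ψ → ψ ∈ Δ := fun {ψ} d =>
    not_not.1 fun hψ => hφ (.mp d (hext ψ hψ))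
  refine ⟨Δ, hΓ, ⟨hclosed, fun {ψ} => ⟨fun hn hp => ?_, fun hp => ?_⟩⟩, fun m => hφ (.hyp m)⟩
  · exact hφ (DAI0.explosion (.hyp hp) (.hyp hn))
  · exact not_not.1 fun hn => hφ (DAI0.cases_on_neg (hext _ hp) (hext _ hn))

/-! ### Complete theories and their one-world models -/

namespace IsCompleteTheory

open Fm

variable {Var : Type} {Δ : Set (Fm Var)} (hΔ : IsCompleteTheory Δ) {φ ψ χ ζ : Fm Var}
include hΔ

theorem mem_of_axiom (h : DAI0Axiom φ) : φ ∈ Δ := hΔ.mem_of_derivable (.ax h)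

theorem mem_mat : mat φ ψ ∈ Δ ↔ (φ ∈ Δ → ψ ∈ Δ) := by
  refine ⟨fun h hφ => hΔ.mem_of_derivable (.mp (.hyp hφ) (.hyp h)), fun h => ?_⟩
  by_cases hφ : φ ∈ Δ
  · exact hΔ.mem_of_derivable (.mat_intro (.hyp (h hφ)))
  · exact hΔ.mem_of_derivable
      (.mp (.mat_intro (.hyp (hΔ.mem_neg.2 hφ))) (.ax (.a3 ψ φ)))

theorem mem_and : Fm.and φ ψ ∈ Δ ↔ φ ∈ Δ ∧ ψ ∈ Δ := by
  -- The abbreviation `¬(¬φ ∨ ¬ψ)` is literally `¬(φ ⊃ ¬ψ)`.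
  change neg (mat φ (neg ψ)) ∈ Δ ↔ _
  rw [hΔ.mem_neg, hΔ.mem_mat, hΔ.mem_neg]
  tauto

theorem mem_equ : equ φ ψ ∈ Δ ↔ (φ ∈ Δ ↔ ψ ∈ Δ) := by
  rw [equ, hΔ.mem_and, hΔ.mem_mat, hΔ.mem_mat]
  exact iff_iff_implies_and_implies.symm

theorem mem_or : Fm.or φ ψ ∈ Δ ↔ φ ∈ Δ ∨ ψ ∈ Δ := by
  rw [hΔ.mem_equ.1 (hΔ.mem_of_axiom (.orDef φ ψ)), hΔ.mem_mat, hΔ.mem_neg]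
  tauto

theorem mem_imp : imp φ ψ ∈ Δ ↔ (φ ∈ Δ → ψ ∈ Δ) ∧ prec ψ φ ∈ Δ := by
  rw [hΔ.mem_equ.1 (hΔ.mem_of_axiom (.a4 φ ψ)), hΔ.mem_and, hΔ.mem_mat]

theorem prec_refl : prec φ φ ∈ Δ := hΔ.mem_of_axiom (.o1 φ)

theorem prec_trans (h₁ : prec φ ψ ∈ Δ) (h₂ : prec ψ χ ∈ Δ) : prec φ χ ∈ Δ :=
  hΔ.mem_mat.1 (hΔ.mem_of_axiom (.o2 φ ψ χ)) (hΔ.mem_and.2 ⟨h₁, h₂⟩)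

theorem prec_neg : prec φ (neg ψ) ∈ Δ ↔ prec φ ψ ∈ Δ :=
  (hΔ.mem_equ.1 (hΔ.mem_and.1 (hΔ.mem_of_axiom (.o4 φ ψ))).1).symm

theorem neg_prec : prec (neg φ) ψ ∈ Δ ↔ prec φ ψ ∈ Δ :=
  (hΔ.mem_equ.1 (hΔ.mem_and.1 (hΔ.mem_of_axiom (.o4 φ ψ))).2).symm

theorem prec_or_left : prec φ (Fm.or φ ψ) ∈ Δ :=
  (hΔ.mem_and.1 (hΔ.mem_of_axiom (.c1 φ ψ))).1

theorem prec_or_right : prec ψ (Fm.or φ ψ) ∈ Δ :=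
  (hΔ.mem_and.1 (hΔ.mem_of_axiom (.c1 φ ψ))).2

theorem or_prec (h₁ : prec φ χ ∈ Δ) (h₂ : prec ψ χ ∈ Δ) : prec (Fm.or φ ψ) χ ∈ Δ :=
  hΔ.mem_mat.1 (hΔ.mem_of_axiom (.c2 φ ψ χ)) (hΔ.mem_and.2 ⟨h₁, h₂⟩)

theorem imp_prec_imp (h₁ : prec φ χ ∈ Δ) (h₂ : prec χ φ ∈ Δ) (h₃ : prec ψ ζ ∈ Δ)
    (h₄ : prec ζ ψ ∈ Δ) : prec (imp φ ψ) (imp χ ζ) ∈ Δ :=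
  hΔ.mem_mat.1 (hΔ.mem_of_axiom (.c3 φ ψ χ ζ))
    (hΔ.mem_and.2 ⟨hΔ.mem_and.2 ⟨hΔ.mem_and.2 ⟨h₁, h₂⟩, h₃⟩, h₄⟩)

/-- Formulae that include each other's content have the same topic. -/
def topicSetoid : Setoid (Fm Var) where
  r φ ψ := prec φ ψ ∈ Δ ∧ prec ψ φ ∈ Δ
  iseqv :=
    { refl := fun _ => ⟨hΔ.prec_refl, hΔ.prec_refl⟩
      symm := fun h => ⟨h.2, h.1⟩
      trans := fun h h' => ⟨hΔ.prec_trans h.1 h'.1, hΔ.prec_trans h'.2 h.2⟩ }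

/-- The topics determined by a complete theory: formulae up to mutual content inclusion. -/
def Topic : Type v := ULift.{v} (Quotient hΔ.topicSetoid)

/-- The topic of a formula. -/
def topic (φ : Fm Var) : hΔ.Topic := ⟨Quotient.mk hΔ.topicSetoid φ⟩

theorem topic_eq_iff : topic.{v} hΔ φ = topic hΔ ψ ↔ prec φ ψ ∈ Δ ∧ prec ψ φ ∈ Δ :=
  ⟨fun h => Quotient.exact (s := hΔ.topicSetoid) (congrArg ULift.down h),
    fun h => congrArg ULift.up (Quotient.sound (s := hΔ.topicSetoid) h)⟩

/-- Topics are ordered by content inclusion, and disjunction gives their joins. -/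
instance : SemilatticeSup (Topic.{v} hΔ) where
  le a b := Quotient.liftOn₂ a.down b.down (fun φ ψ => prec φ ψ ∈ Δ)
    (fun _ _ _ _ h₁ h₂ => propext
      ⟨fun h => hΔ.prec_trans h₁.2 (hΔ.prec_trans h h₂.1),
        fun h => hΔ.prec_trans h₁.1 (hΔ.prec_trans h h₂.2)⟩)
  le_refl := by
    rintro ⟨⟨φ⟩⟩
    exact hΔ.prec_refl
  le_trans := by
    rintro ⟨⟨φ⟩⟩ ⟨⟨ψ⟩⟩ ⟨⟨χ⟩⟩ h₁ h₂
    exact hΔ.prec_trans h₁ h₂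
  le_antisymm := by
    rintro ⟨⟨φ⟩⟩ ⟨⟨ψ⟩⟩ h₁ h₂
    exact hΔ.topic_eq_iff.2 ⟨h₁, h₂⟩
  sup a b := ⟨Quotient.map₂ (sa := hΔ.topicSetoid) (sb := hΔ.topicSetoid) (sc := hΔ.topicSetoid) Fm.or
    (fun _ _ h₁ _ _ h₂ =>
    ⟨hΔ.or_prec (hΔ.prec_trans h₁.1 hΔ.prec_or_left) (hΔ.prec_trans h₂.1 hΔ.prec_or_right),
      hΔ.or_prec (hΔ.prec_trans h₁.2 hΔ.prec_or_left) (hΔ.prec_trans h₂.2 hΔ.prec_or_right)⟩)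
    a.down b.down⟩
  le_sup_left := by
    rintro ⟨⟨φ⟩⟩ ⟨⟨ψ⟩⟩
    exact hΔ.prec_or_left
  le_sup_right := by
    rintro ⟨⟨φ⟩⟩ ⟨⟨ψ⟩⟩
    exact hΔ.prec_or_right
  sup_le := by
    rintro ⟨⟨φ⟩⟩ ⟨⟨ψ⟩⟩ ⟨⟨χ⟩⟩ h₁ h₂
    exact hΔ.or_prec h₁ h₂

theorem topic_or : topic.{v} hΔ (Fm.or φ ψ) = topic hΔ φ ⊔ topic hΔ ψ := rfl

theorem topic_neg : topic.{v} hΔ (neg φ) = topic hΔ φ :=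
  hΔ.topic_eq_iff.2 ⟨hΔ.neg_prec.2 hΔ.prec_refl, hΔ.prec_neg.2 hΔ.prec_refl⟩

/-- The operation on topics induced by the arrow. -/
def topicCond (a b : Topic.{v} hΔ) : Topic.{v} hΔ :=
  ⟨Quotient.map₂ (sa := hΔ.topicSetoid) (sb := hΔ.topicSetoid) (sc := hΔ.topicSetoid) imp
    (fun _ _ h₁ _ _ h₂ =>
    ⟨hΔ.imp_prec_imp h₁.1 h₁.2 h₂.1 h₂.2, hΔ.imp_prec_imp h₁.2 h₁.1 h₂.2 h₂.1⟩) a.down b.down⟩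

/-- The one-world model of a complete theory. -/
def canonicalModel : CAPAIModel.{u, v} Var where
  W := PUnit
  R _ _ := True
  R_refl _ := trivial
  R_trans _ _ _ _ _ := trivial
  T _ := Topic.{v} hΔ
  cond _ := hΔ.topicCond
  val p := {_w | var p ∈ Δ}
  t _ φ := hΔ.topic φ.unfold
  t_neg _ _ := hΔ.topic_neg
  t_and _ φ ψ := by
    change hΔ.topic (neg (Fm.or (neg φ.unfold) (neg ψ.unfold))) = _
    rw [hΔ.topic_neg, hΔ.topic_or, hΔ.topic_neg, hΔ.topic_neg]
  t_or _ _ _ := rfl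
  t_imp _ _ _ := rfl
  h _ _ _ := id
  h_sup _ _ _ _ _ := rfl
  h_cond _ _ _ _ _ := rfl
  h_var _ _ _ _ := rfl

/-- Truth lemma for the canonical model. -/
theorem forces_iff (w : (canonicalModel.{u, v} hΔ).W) (φ : FmC Var) :
    (canonicalModel.{u, v} hΔ).Forces w φ ↔ φ.unfold ∈ Δ := by
  induction φ with
  | var p => exact Iff.rfl
  | neg φ ih => simp only [CAPAIModel.Forces, FmC.unfold, hΔ.mem_neg, ih]
  | and φ ψ ih₁ ih₂ => simp only [CAPAIModel.Forces, FmC.unfold, hΔ.mem_and, ih₁, ih₂]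
  | or φ ψ ih₁ ih₂ => simp only [CAPAIModel.Forces, FmC.unfold, hΔ.mem_or, ih₁, ih₂]
  | imp φ ψ ih₁ ih₂ =>
    simp only [CAPAIModel.Forces, FmC.unfold, hΔ.mem_imp]
    rw [and_comm]
    -- With one world, strict implication is material; the order on topics is membership of `≺` by
    -- definition.
    refine and_congr ⟨fun h hφ => ih₂.1 (h w trivial (ih₁.2 hφ)), fun h w' _ hφ => ?_⟩ Iff.rfl
    exact ih₂.2 (h (ih₁.1 hφ))

/-- In a one-world model only the topic condition is at stake, and the topic of `ψ` is a joinand of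
that of `ψ ⊃ ψ`. -/
theorem forces_demodalizer (w : (canonicalModel.{u, v} hΔ).W) {φ : FmC Var}
    (h : φ ∈ demodalizer Var) : (canonicalModel.{u, v} hΔ).Forces w φ := by
  obtain ⟨ψ, rfl⟩ := h
  refine or_iff_not_imp_left.2 fun hψ => ⟨?_, fun _ _ _ => not_not.1 hψ⟩
  exact le_sup_right.trans_eq ((canonicalModel.{u, v} hΔ).t_or w _ _).symm

end IsCompleteTheory

/-! ### Soundness at worlds satisfying the demodalizing schema -/

namespace CAPAIModel

variable {Var : Type} (M : CAPAIModel.{u, v} Var)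

theorem t_unfold (w : M.W) (φ : FmC Var) : M.t w φ.unfold.incl = M.t w φ := by
  induction φ with
  | var p => rfl
  | neg φ ih => simp only [FmC.unfold, Fm.incl, M.t_neg, ih]
  | and φ ψ ih₁ ih₂ => simp only [FmC.unfold, Fm.and, Fm.incl, M.t_neg, M.t_or, M.t_and, ih₁, ih₂]
  | or φ ψ ih₁ ih₂ => simp only [FmC.unfold, Fm.incl, M.t_or, ih₁, ih₂]
  | imp φ ψ ih₁ ih₂ => simp only [FmC.unfold, Fm.incl, M.t_imp, ih₁, ih₂]

theorem forces_unfold (w : M.W) (φ : FmC Var) :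
    M.Forces w φ.unfold.incl ↔ M.Forces w φ := by
  induction φ generalizing w with
  | var p => rfl
  | neg φ ih => simp only [FmC.unfold, Fm.incl, Forces, ih]
  | and φ ψ ih₁ ih₂ => simp only [FmC.unfold, Fm.and, Fm.incl, Forces, ih₁, ih₂]; tauto
  | or φ ψ ih₁ ih₂ => simp only [FmC.unfold, Fm.incl, Forces, ih₁, ih₂]
  | imp φ ψ ih₁ ih₂ => simp only [FmC.unfold, Fm.incl, Forces, ih₁, ih₂, M.t_unfold]

variable {M} {w : M.W}

/-- Under the demodalizing schema, truth is constant along the accessibility relation. -/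
theorem forces_congr (hw : ∀ γ ∈ demodalizer Var, M.Forces w γ) {w' : M.W} (r : M.R w w')
    (φ : FmC Var) : M.Forces w' φ ↔ M.Forces w φ := by
  -- The schema turns a true `ψ` into `(ψ ⊃ ψ) → ψ`, whose antecedent holds at every successor.
  have key : ∀ ψ : FmC Var, M.Forces w ψ → M.Forces w' ψ := fun ψ hψ =>
    ((hw _ ⟨ψ, rfl⟩).resolve_left (not_not.2 hψ)).2 w' r (em _).symm
  exact ⟨fun h => not_not.1 fun hn => key (.neg φ) hn h, key φ⟩

theorem forces_imp_iff (hw : ∀ γ ∈ demodalizer Var, M.Forces w γ) (φ ψ : FmC Var) :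
    M.Forces w (.imp φ ψ) ↔ M.t w ψ ≤ M.t w φ ∧ (M.Forces w φ → M.Forces w ψ) :=
  and_congr_right fun _ => ⟨fun h => h w (M.R_refl w), fun h w' r => by
    rwa [forces_congr hw r, forces_congr hw r]⟩

/-- The consequent `φ ∨ ¬φ` is always true and, by idempotence of join, has the topic of `φ`; only
the topic condition remains. -/
theorem forces_incl_prec (hw : ∀ γ ∈ demodalizer Var, M.Forces w γ) (φ ψ : Fm Var) :
    M.Forces w (Fm.prec φ ψ).incl ↔ M.t w φ.incl ≤ M.t w ψ.incl := by
  simp only [Fm.prec, Fm.incl, forces_imp_iff hw, M.t_or, M.t_neg, sup_idem, Forces]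
  tauto

theorem forces_incl_and (φ ψ : Fm Var) :
    M.Forces w (Fm.and φ ψ).incl ↔ M.Forces w φ.incl ∧ M.Forces w ψ.incl := by
  simp only [Fm.and, Fm.incl, Forces]
  tauto

theorem forces_incl_mat (φ ψ : Fm Var) :
    M.Forces w (Fm.mat φ ψ).incl ↔ (M.Forces w φ.incl → M.Forces w ψ.incl) := by
  simp only [Fm.mat, Fm.incl, Forces]
  tauto

theorem forces_incl_equ (φ ψ : Fm Var) :
    M.Forces w (Fm.equ φ ψ).incl ↔ (M.Forces w φ.incl ↔ M.Forces w ψ.incl) := by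
  rw [Fm.equ, forces_incl_and, forces_incl_mat, forces_incl_mat]
  exact iff_iff_implies_and_implies.symm

theorem forces_incl_axiom (hw : ∀ γ ∈ demodalizer Var, M.Forces w γ) {φ : Fm Var}
    (h : DAI0Axiom φ) : M.Forces w φ.incl := by
  cases h <;> simp only [forces_incl_and, forces_incl_mat, forces_incl_equ, forces_incl_prec hw]
  case a1 => tauto
  case a2 => tauto
  case a3 => simp only [Fm.incl, Forces]; tauto
  case orDef => simp only [Fm.incl, Forces]; tauto
  case a4 => simp only [Fm.incl, forces_imp_iff hw]; tauto
  case o1 => exact le_rfl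
  case o2 => exact fun h => h.1.trans h.2
  case o3 => exact fun h => (M.t_or w _ _).trans_le (sup_le h le_rfl)
  case o4 => simp only [Fm.incl, M.t_neg, and_self]
  case c1 => simp only [Fm.incl, M.t_or, le_sup_left, le_sup_right, and_self]
  case c2 => exact fun h => (M.t_or w _ _).trans_le (sup_le h.1 h.2)
  case c3 =>
    rintro ⟨⟨⟨h₁, h₂⟩, h₃⟩, h₄⟩
    -- Mutual inclusion is equality of topics, so an arbitrary operation `cond` respects it.
    simp only [Fm.incl, M.t_imp, le_antisymm h₁ h₂, le_antisymm h₃ h₄, le_refl]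

theorem forces_incl_of_derivable (hw : ∀ γ ∈ demodalizer Var, M.Forces w γ) {Γ : Set (Fm Var)}
    (hΓ : ∀ γ ∈ Γ, M.Forces w γ.incl) {φ : Fm Var} (d : DAI0 Γ φ) : M.Forces w φ.incl := by
  induction d with
  | hyp m => exact hΓ _ m
  | ax a => exact forces_incl_axiom hw a
  | mp _ _ ih₁ ih₂ => exact (forces_incl_mat _ _).1 ih₂ ih₁

end CAPAIModel

theorem Fm.unfold_incl {Var : Type} (φ : Fm Var) : φ.incl.unfold = φ := by
  induction φ with
  | var p => rfl
  | neg φ ih => simp only [incl, FmC.unfold, ih]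
  | or φ ψ ih₁ ih₂ => simp only [incl, FmC.unfold, ih₁, ih₂]
  | imp φ ψ ih₁ ih₂ => simp only [incl, FmC.unfold, ih₁, ih₂]

/-- Soundness and completeness of `DAI₀` for `CA-DAI`. -/
theorem cadai_iff_dai0_unfold {Var : Type} (Γ : Set (FmC Var)) (φ : FmC Var) :
    CADAI.{u, v} Γ φ ↔ DAI0 (FmC.unfold '' Γ) φ.unfold := by
  refine ⟨fun h => not_not.1 fun hn => ?_, fun d M w hw => ?_⟩
  · obtain ⟨Δ, hΓ, hΔ, hφ⟩ := exists_isCompleteTheory hn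
    refine hφ ((hΔ.forces_iff PUnit.unit φ).1 (h hΔ.canonicalModel PUnit.unit ?_))
    rintro γ (hγ | hγ)
    · exact (hΔ.forces_iff _ γ).2 (hΓ ⟨γ, hγ, rfl⟩)
    · exact hΔ.forces_demodalizer _ hγ
  · refine (M.forces_unfold w φ).1 (CAPAIModel.forces_incl_of_derivable
      (fun γ hγ => hw γ (Or.inr hγ)) ?_ d)
    rintro _ ⟨γ, hγ, rfl⟩
    exact (M.forces_unfold w γ).2 (hw γ (Or.inl hγ))

end AnalyticImplication

theorem mainTheorem11 (Var : Type) [Countable Var] :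
    (∀ (Γ : Set (AnalyticImplication.Fm Var)) (φ : AnalyticImplication.Fm Var),
      AnalyticImplication.DAI0 Γ φ ↔
        AnalyticImplication.CADAI.{u, v} (AnalyticImplication.Fm.incl '' Γ) φ.incl) ∧
    (∀ (Γ : Set (AnalyticImplication.FmC Var)) (φ : AnalyticImplication.FmC Var),
      AnalyticImplication.CADAI.{u, v} Γ φ ↔
        AnalyticImplication.DAI0 (AnalyticImplication.FmC.unfold '' Γ) φ.unfold) := by
  refine ⟨fun Γ φ => ?_, AnalyticImplication.cadai_iff_dai0_unfold⟩
  simp only [AnalyticImplication.cadai_iff_dai0_unfold, Set.image_image,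
    AnalyticImplication.Fm.unfold_incl, Set.image_id']
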